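/- Let $T$ be an abelian group. A \emph{system} $(X,\sigma)$ is an action $\sigma$ of $T$ by homeomorphisms on a compact Hausdorff space $X$; a \emph{factor map} is a continuous $T$-equivariant surjection. Let $\pi_{eq}:X\to X_{eq}$ be the maximal equicontinuous factor. Two points are \emph{proximal} if they become arbitrarily close (for the unique uniformity of $X$) under a common $\sigma^t$; the system is \emph{distal} if distinct points are never proximal. A point $\xi\in X_{eq}$ is \emph{singular} if $\pi_{eq}^{-1}(\xi)$ contains two distinct proximal points, and \emph{regular} otherwise. If $X$ is minimal, $X_{eq}$ carries a unique topological abelian group structure with a prescribed neutral element $0$ on which $T$ acts by translations; for minimal non-distal systems we fix $0$ to be a singular point. The \emph{Ellis semigroup} $E(X)$ is the closure of $\{\sigma^t:t\in T\}$ in the space of all maps $X\to X$ with the topology of pointwise convergence; it is a monoid under composition on which $T$ acts by $f\mapsto\sigma^t\circ f$. An \emph{Ellis morphism} $\Phi:E(X)\to E(X')$ is a continuous $T$-equivariant monoid morphism. A factor map $\phi:X\to X'$ induces the Ellis morphism $\phi_*$ given by $\phi_*(f)(\phi(y))=\phi(f(y))$. An idempotent $e\in E(X)$ is \emph{minimal}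 if $ep=pe=p$ for an idempotent $p$ implies $p=e$. Given such an $e$, let $L=E(X)e$ (a minimal left ideal), $J_L$ its set of idempotents, and $\mathcal G=eL$, a group with neutral element $e$, endowed with the topology of pointwise convergence. Let $\Gamma\subset\mathcal G$ be the subgroup generated by all products $qp$, where $q$ is an idempotent of $eE(X)$ and $p\in J_L$ (the entries of the sandwich matrix, normalised at $e$, of the kernel of $E(X)$ as a Rees matrix semigroup). Let $\widetilde\pi_{eq}:L\to X_{eq}$, $\widetilde\pi_{eq}(f)=(\pi_{eq})_*(f)(0)$, and $\mathcal G^{fib}=\{g\in\mathcal G:\widetilde\pi_{eq}(g)=0\}$. The system has \emph{no extra spectrum} (NES) if the closure in $\mathcal G$ of the normal closure of $\Gamma$ in $\mathcal G$ equals $\mathcal G^{fib}$. Let $\pi^L_{eq}:L\to L_{eq}$ be the maximal equicontinuous factor of $L$ and $\eta_0:L_{eq}\to X_{eq}$ the factor map with $\eta_0\circ\pi_{eq}^L=\widetilde\pi_{eq}$; it is bijective if $X$ is minimal and NES. Put $\mathrm{stab}_{\mathcal G}(x)=\{g\in\mathcal G: g(x)=x\}$. \textbf{Theorem.} Let $(X,\sigma)$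 and $(X',\sigma')$ be minimal, non-distal systems of the same abelian group $T$, and let $\Phi:E(X)\to E(X')$ be an Ellis morphism. Let $e\in E(X)$ be a minimal idempotent, $L=E(X)e$, and let $e'=\Phi(e)$, which is a minimal idempotent of $E(X')$; define $L'=E(X')e'$, $\mathcal G'$, $\Gamma'$, $\mathcal G'^{fib}$, $\eta_0'$ as above, using $e'$. Assume that both systems have no extra spectrum. Let $\Phi_{eq}:L_{eq}\to L'_{eq}$ be the map induced by $\Phi|_L:L\to L'$, and $\widetilde{\Phi_{eq}}=\eta_0'\circ\Phi_{eq}\circ\eta_0^{-1}:X_{eq}\to X'_{eq}$. Let $x\in e(\pi_{eq}^{-1}(0))$ and $x'\in e'(\pi_{eq}'^{-1}(0))$. If \begin{enumerate} \item for every singular $\xi\in X_{eq}$ and every $y\in\pi_{eq}^{-1}(\xi)$, the map $J_L\to X$, $p\mapsto p(y)$, is injective, \item $\widetilde{\Phi_{eq}}$ maps regular points of $X_{eq}$ to regular points of $X'_{eq}$, and \item $\Phi(\mathrm{stab}_{\mathcal G}(x))\subset\mathrm{stab}_{\mathcal G'}(x')$, \end{enumerate} then there is a factor map $\phi:X\to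 X'$ with $\phi(x)=x'$ and $\Phi=\phi_*$. -/

import Mathlib

open Topology

universe u v w

namespace EllisTheory

/-! ### Dynamical systems

A system is an action of a group `T` by homeomorphisms (`ContinuousConstSMul`) on a compact
Hausdorff space. -/

section Systems

/-- Proximality, formulated with the unique uniformity of a compact Hausdorff space; for a metric
`d` inducing the topology it says `inf_t d (t • x) (t • y) = 0`. -/
def Proximal (T : Type w) {X : Type u} [Group T] [TopologicalSpace X] [CompactSpace X] [T2Space X]
    [MulAction T X] (x y : X) : Prop :=
  ∀ V ∈ (uniformSpaceOfCompactR1 (γ := X)).uniformity, ∃ t : T, (t • x, t • y) ∈ V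

/-- Distality: distinct points are never proximal. -/
def IsDistal (T : Type w) (X : Type u) [Group T] [TopologicalSpace X] [CompactSpace X] [T2Space X]
    [MulAction T X] : Prop :=
  ∀ x y : X, Proximal T x y → x = y

/-- Equicontinuity of the family of all `x ↦ t • x`, for the unique uniformity. -/
def IsEquicontinuous (T : Type w) (X : Type u) [Group T] [TopologicalSpace X] [CompactSpace X]
    [T2Space X] [MulAction T X] : Prop :=
  @Equicontinuous T X X _ uniformSpaceOfCompactR1 (fun (t : T) (x : X) => t • x)

/-- Factor maps: continuous equivariant surjections. -/
structure IsFactorMap (T : Type w) {X : Type u} {Y : Type v} [Group T] [TopologicalSpace X]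
    [TopologicalSpace Y] [MulAction T X] [MulAction T Y] (φ : X → Y) : Prop where
  continuous : Continuous φ
  surjective : Function.Surjective φ
  map_smul : ∀ (t : T) (x : X), φ (t • x) = t • φ x

theorem compact_t2_topology_eq {Z : Type u} (t t' : TopologicalSpace Z) (hc : @CompactSpace Z t)
    (h2 : @T2Space Z t') (hle : t ≤ t') : t = t' := by
  have hcont : @Continuous Z Z t t' id := continuous_id_iff_le.mpr hle
  have hemb := @Continuous.isClosedEmbedding Z Z t t' hc h2 id hcont Function.injective_id
  obtain ⟨⟨⟨h⟩, -⟩, -⟩ := hemb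
  rwa [@induced_id Z t'] at h

/-- A system with enough factor-like maps to equicontinuous systems is equicontinuous. -/
theorem isEquicontinuous_of_separating {T : Type w} [Group T] {κ : Type*} {Z : Type u}
    [TopologicalSpace Z] [CompactSpace Z] [T2Space Z] [MulAction T Z]
    (Y : κ → Type v) [∀ k, TopologicalSpace (Y k)] [∀ k, CompactSpace (Y k)] [∀ k, T2Space (Y k)]
    [∀ k, MulAction T (Y k)] (hY : ∀ k, IsEquicontinuous T (Y k))
    (f : ∀ k, Z → Y k) (hf : ∀ k, Continuous (f k)) (hfT : ∀ k (t : T) z, f k (t • z) = t • f k z)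
    (hsep : ∀ z z', (∀ k, f k z = f k z') → z = z') : IsEquicontinuous T Z := by
  let uY : ∀ k, UniformSpace (Y k) := fun k => uniformSpaceOfCompactR1
  let u : UniformSpace Z := ⨅ k, (uY k).comap (f k)
  have htop : u.toTopologicalSpace = ⨅ k, TopologicalSpace.induced (f k) inferInstance := by
    simp only [u, UniformSpace.toTopologicalSpace_iInf]
    rfl
  have hfu : ∀ k, @Continuous Z (Y k) u.toTopologicalSpace _ (f k) := by
    intro k
    rw [htop]
    exact continuous_iInf_dom continuous_induced_dom
  have h2 : @T2Space Z u.toTopologicalSpace := by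
    refine @T2Space.mk Z u.toTopologicalSpace fun z z' hzz' => ?_
    have : ∃ k, f k z ≠ f k z' := by
      by_contra h
      push Not at h
      exact hzz' (hsep z z' h)
    obtain ⟨k, hk⟩ := this
    obtain ⟨U, V, hU, hV, hzU, hzV, hd⟩ := t2_separation hk
    exact ⟨f k ⁻¹' U, f k ⁻¹' V, (@continuous_def Z (Y k) u.toTopologicalSpace _ _).1 (hfu k) U hU,
      (@continuous_def Z (Y k) u.toTopologicalSpace _ _).1 (hfu k) V hV,
      hzU, hzV, hd.preimage _⟩
  have hle : (inferInstance : TopologicalSpace Z) ≤ u.toTopologicalSpace := by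
    rw [htop]
    exact le_iInf fun k => (hf k).le_induced
  have heq := compact_t2_topology_eq _ u.toTopologicalSpace inferInstance h2 hle
  have hu : uniformSpaceOfCompactR1 (γ := Z) = u := unique_uniformity_of_compact rfl heq.symm
  unfold IsEquicontinuous
  rw [hu, equicontinuous_iInf_rng]
  intro k
  let := uY k
  let := (uY k).comap (f k)
  have hind : IsUniformInducing (f k) := ⟨rfl⟩
  rw [hind.equicontinuous_iff]
  have hk : Equicontinuous (fun (t : T) (y : Y k) => t • y) := hY k
  intro z
  have h1 := (hk (f k z))
  intro V hV
  have h3 := (hf k).continuousAt.eventually (h1 V hV)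
  filter_upwards [h3] with z' hz' t
  simpa [hfT] using hz' t

end Systems

/-! ### The maximal equicontinuous factor -/

section MEF

/-- The equicontinuous structure relation: two points are related iff every equicontinuous factor
identifies them. -/
def eqSetoid (T : Type w) (X : Type u) [Group T] [TopologicalSpace X] [MulAction T X] :
    Setoid X where
  r x y := ∀ (Y : Type u) [TopologicalSpace Y] [CompactSpace Y] [T2Space Y] [MulAction T Y]
    [ContinuousConstSMul T Y], IsEquicontinuous T Y → ∀ π : X → Y, IsFactorMap T π → π x = π y
  iseqv :=
    { refl := fun _ _ _ _ _ _ _ _ _ _ => rfl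
      symm := fun h Y _ _ _ _ _ hY π hπ => (h Y hY π hπ).symm
      trans := fun h h' Y _ _ _ _ _ hY π hπ => (h Y hY π hπ).trans (h' Y hY π hπ) }

/-- The space `X_eq` of the maximal equicontinuous factor of `X`. -/
def MEF (T : Type w) (X : Type u) [Group T] [TopologicalSpace X] [MulAction T X] : Type u :=
  Quotient (eqSetoid T X)

variable {T : Type w} {X : Type u} [Group T] [TopologicalSpace X] [MulAction T X]

/-- The factor map `π_eq : X → X_eq`. -/
def piEq (T : Type w) {X : Type u} [Group T] [TopologicalSpace X] [MulAction T X] (x : X) :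
    MEF T X :=
  Quotient.mk (eqSetoid T X) x

instance : TopologicalSpace (MEF T X) := inferInstanceAs (TopologicalSpace (Quotient _))

instance [CompactSpace X] : CompactSpace (MEF T X) := inferInstanceAs (CompactSpace (Quotient _))

theorem piEq_surjective : Function.Surjective (piEq T : X → MEF T X) := Quotient.mk_surjective

theorem continuous_piEq : Continuous (piEq T : X → MEF T X) := continuous_quotient_mk'

theorem piEq_eq_iff {x y : X} : piEq T x = piEq T y ↔ eqSetoid T X x y := Quotient.eq

instance : MulAction T (MEF T X) where
  smul t := Quotient.map (fun x => t • x) (by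
    intro x y h Y _ _ _ _ _ hY π hπ
    rw [hπ.map_smul, hπ.map_smul, h Y hY π hπ])
  one_smul ξ := by
    obtain ⟨x, rfl⟩ := piEq_surjective ξ
    change piEq T ((1 : T) • x) = _
    rw [one_smul]
  mul_smul s t ξ := by
    obtain ⟨x, rfl⟩ := piEq_surjective ξ
    change piEq T ((s * t) • x) = piEq T (s • t • x)
    rw [mul_smul]

theorem piEq_smul (t : T) (x : X) : piEq T (t • x) = t • piEq T x := rfl

theorem isFactorMap_piEq : IsFactorMap T (piEq T : X → MEF T X) :=
  ⟨continuous_piEq, piEq_surjective, piEq_smul⟩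

instance [ContinuousConstSMul T X] : ContinuousConstSMul T (MEF T X) where
  continuous_const_smul t :=
    continuous_quot_lift _ (continuous_piEq.comp (continuous_const_smul t))

instance : T2Space (MEF T X) where
  t2 := by
    intro ξ ζ hne
    obtain ⟨x, rfl⟩ := piEq_surjective ξ
    obtain ⟨y, rfl⟩ := piEq_surjective ζ
    have hxy : ¬ eqSetoid T X x y := fun h => hne (piEq_eq_iff.mpr h)
    by_contra hcon
    apply hxy
    intro Y _ _ _ _ _ hY π hπ
    by_contra hk
    apply hcon
    obtain ⟨U, V, hU, hV, hxU, hyV, hd⟩ := t2_separation hk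
    let g : MEF T X → Y := Quotient.lift π (fun a b h => h Y hY π hπ)
    have hg : Continuous g := continuous_quot_lift _ hπ.continuous
    exact ⟨g ⁻¹' U, g ⁻¹' V, hU.preimage hg, hV.preimage hg, hxU, hyV, hd.preimage _⟩

instance [MulAction.IsMinimal T X] : MulAction.IsMinimal T (MEF T X) where
  dense_orbit := by
    intro ξ
    obtain ⟨x, rfl⟩ := piEq_surjective ξ
    have h := (piEq_surjective (T := T) (X := X)).denseRange.dense_image continuous_piEq
      (MulAction.dense_orbit T x)
    refine h.mono ?_
    rintro _ ⟨_, ⟨t, rfl⟩, rfl⟩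
    exact ⟨t, rfl⟩

/-- The maximal equicontinuous factor is equicontinuous. -/
theorem isEquicontinuous_MEF [CompactSpace X] : IsEquicontinuous T (MEF T X) := by
  let κ := {ξζ : MEF T X × MEF T X // ξζ.1 ≠ ξζ.2}
  have key : ∀ k : κ, ∃ (Y : Type u) (_ : TopologicalSpace Y) (_ : CompactSpace Y) (_ : T2Space Y)
      (_ : MulAction T Y), IsEquicontinuous T Y ∧ ∃ f : MEF T X → Y, Continuous f ∧
        (∀ (t : T) ξ, f (t • ξ) = t • f ξ) ∧ f k.1.1 ≠ f k.1.2 := by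
    rintro ⟨⟨ξ, ζ⟩, hne⟩
    obtain ⟨x, rfl⟩ := piEq_surjective ξ
    obtain ⟨y, rfl⟩ := piEq_surjective ζ
    have hxy : ¬ eqSetoid T X x y := fun h => hne (piEq_eq_iff.mpr h)
    by_contra hcon
    apply hxy
    intro Y i1 i2 i3 i4 _ hY π hπ
    by_contra hk
    apply hcon
    refine ⟨Y, i1, i2, i3, i4, hY, Quotient.lift π (fun a b h => h Y hY π hπ),
      continuous_quot_lift _ hπ.continuous, ?_, hk⟩
    intro t ξ
    obtain ⟨x, rfl⟩ := piEq_surjective ξ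
    exact hπ.map_smul t x
  choose Y i1 i2 i3 i4 hY f hf hfT hsep using key
  refine isEquicontinuous_of_separating Y hY f hf hfT ?_
  intro ξ ζ h
  by_contra hne
  exact hsep ⟨(ξ, ζ), hne⟩ (h _)

/-- An equicontinuous factor (in any universe) identifies related points. -/
theorem eq_of_eqSetoid [CompactSpace X] [ContinuousConstSMul T X] {Y : Type v} [TopologicalSpace Y]
    [CompactSpace Y] [T2Space Y] [MulAction T Y] (hY : IsEquicontinuous T Y) {π : X → Y}
    (hπ : IsFactorMap T π) {x y : X} (h : eqSetoid T X x y) : π x = π y := by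
  let S : Setoid X := Setoid.ker π
  let Z : Type u := Quotient S
  let q : X → Z := Quotient.mk S
  have hq : Function.Surjective q := Quotient.mk_surjective
  have hqc : Continuous q := continuous_quotient_mk'
  let g : Z → Y := Quotient.lift π (fun _ _ h => h)
  have hg : Continuous g := continuous_quot_lift _ hπ.continuous
  have hginj : Function.Injective g := by
    intro a b hab
    obtain ⟨a, rfl⟩ := hq a
    obtain ⟨b, rfl⟩ := hq b
    exact Quotient.sound hab
  have hT2 : T2Space Z := T2Space.of_injective_continuous hginj hg
  have hC : CompactSpace Z := inferInstanceAs (CompactSpace (Quotient S))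
  let act : MulAction T Z :=
    { smul := fun t => Quotient.map (fun x => t • x) (by
        intro a b hab
        change π (t • a) = π (t • b)
        rw [hπ.map_smul, hπ.map_smul, show π a = π b from hab])
      one_smul := fun z => by
        obtain ⟨a, rfl⟩ := hq z
        change q ((1 : T) • a) = q a
        rw [one_smul]
      mul_smul := fun s t z => by
        obtain ⟨a, rfl⟩ := hq z
        change q ((s * t) • a) = q (s • t • a)
        rw [mul_smul] }
  have hact : ContinuousConstSMul T Z :=
    ⟨fun t => continuous_quot_lift _ (hqc.comp (continuous_const_smul t))⟩
  have hgT : ∀ (t : T) z, g (t • z) = t • g z := by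
    intro t z
    obtain ⟨a, rfl⟩ := hq z
    exact hπ.map_smul t a
  have hZ : IsEquicontinuous T Z :=
    isEquicontinuous_of_separating (κ := Unit) (fun _ => Y) (fun _ => hY) (fun _ => g)
      (fun _ => hg) (fun _ => hgT) (fun a b h => hginj (h ()))
  have := h Z hZ q ⟨hqc, hq, fun _ _ => rfl⟩
  exact congrArg g this

/-- The map `X_eq → Y` through which an equicontinuous factor `π : X → Y` factors. -/
def mefLift [CompactSpace X] [ContinuousConstSMul T X] {Y : Type v} [TopologicalSpace Y]
    [CompactSpace Y] [T2Space Y] [MulAction T Y] (hY : IsEquicontinuous T Y) {π : X → Y}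
    (hπ : IsFactorMap T π) : MEF T X → Y :=
  Quotient.lift π (fun _ _ h => eq_of_eqSetoid hY hπ h)

theorem mefLift_piEq [CompactSpace X] [ContinuousConstSMul T X] {Y : Type v} [TopologicalSpace Y]
    [CompactSpace Y] [T2Space Y] [MulAction T Y] (hY : IsEquicontinuous T Y) {π : X → Y}
    (hπ : IsFactorMap T π) (x : X) : mefLift hY hπ (piEq T x) = π x := rfl

/-- A point of `X_eq` is singular if its fibre contains two distinct proximal points. -/
def IsSingular [CompactSpace X] [T2Space X] (ξ : MEF T X) : Prop :=
  ∃ y z : X, piEq T y = ξ ∧ piEq T z = ξ ∧ y ≠ z ∧ Proximal T y z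

/-- A point of `X_eq` is regular if it is not singular. -/
def IsRegular [CompactSpace X] [T2Space X] (ξ : MEF T X) : Prop := ¬ IsSingular ξ

end MEF

/-! ### The Ellis semigroup -/

section Ellis

/-- The Ellis semigroup `E(X)`: the closure of the family of all `x ↦ t • x` in the space of
functions `X → X` with the topology of pointwise convergence. -/
def Ellis (T : Type w) (X : Type u) [Group T] [TopologicalSpace X] [MulAction T X] : Type u :=
  {f : X → X // f ∈ closure (Set.range fun (t : T) (x : X) => t • x)}

variable {T : Type w} {X : Type u} {Y : Type v} [Group T] [TopologicalSpace X] [MulAction T X]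
  [TopologicalSpace Y] [MulAction T Y]

instance : CoeFun (Ellis T X) (fun _ => X → X) := ⟨Subtype.val⟩

instance : TopologicalSpace (Ellis T X) := inferInstanceAs (TopologicalSpace (Subtype _))

instance [CompactSpace X] : CompactSpace (Ellis T X) :=
  isCompact_iff_compactSpace.mp isClosed_closure.isCompact

instance [T2Space X] : T2Space (Ellis T X) := inferInstanceAs (T2Space (Subtype _))

theorem Ellis.ext {f g : Ellis T X} (h : ∀ x, f x = g x) : f = g := Subtype.ext (funext h)

theorem Ellis.continuous_eval (x : X) : Continuous (fun f : Ellis T X => f x) :=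
  (continuous_apply x).comp continuous_subtype_val

/-- The element `σ^t` of `E(X)`. -/
def Ellis.ofGroup (X : Type u) [TopologicalSpace X] [MulAction T X] (t : T) : Ellis T X :=
  ⟨fun x => t • x, subset_closure ⟨t, rfl⟩⟩

theorem Ellis.denseRange_ofGroup : DenseRange (Ellis.ofGroup X : T → Ellis T X) := by
  intro f
  refine closure_subtype.mpr ?_
  have hf := f.2
  refine closure_mono ?_ hf
  rintro _ ⟨t, rfl⟩
  exact ⟨_, ⟨t, rfl⟩, rfl⟩

/-- The action `σ_E` of `T` on `E(X)`, `(t • f)(x) = t • f x`. -/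
instance [ContinuousConstSMul T X] : MulAction T (Ellis T X) where
  smul t f := ⟨fun x => t • f x, by
    have hc : Continuous (fun (g : X → X) (x : X) => t • g x) :=
      continuous_pi fun x => (continuous_apply x).const_smul t
    refine map_mem_closure hc f.2 ?_
    rintro _ ⟨s, rfl⟩
    exact ⟨t * s, funext fun x => mul_smul t s x⟩⟩
  one_smul f := Ellis.ext fun x => one_smul T (f x)
  mul_smul s t f := Ellis.ext fun x => mul_smul s t (f x)

theorem Ellis.smul_apply [ContinuousConstSMul T X] (t : T) (f : Ellis T X) (x : X) :
    (t • f) x = t • f x := rfl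

instance [ContinuousConstSMul T X] : ContinuousConstSMul T (Ellis T X) where
  continuous_const_smul t := Continuous.subtype_mk
    (continuous_pi fun x => (Ellis.continuous_eval x).const_smul t) _

/-- `E(X)` is a monoid under composition. -/
instance [ContinuousConstSMul T X] : Monoid (Ellis T X) where
  mul f g := ⟨fun x => f (g x), by
    have hc : Continuous (fun (h : X → X) (x : X) => h (g x)) :=
      continuous_pi fun x => continuous_apply (g x)
    have := map_mem_closure (t := closure (Set.range fun (t : T) (x : X) => t • x)) hc f.2 (by
      rintro _ ⟨s, rfl⟩
      exact (s • g).2)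
    rwa [closure_closure] at this⟩
  one := ⟨fun x => x, subset_closure ⟨1, funext fun x => one_smul T x⟩⟩
  mul_assoc _ _ _ := rfl
  one_mul _ := rfl
  mul_one _ := rfl

theorem Ellis.mul_apply [ContinuousConstSMul T X] (f g : Ellis T X) (x : X) :
    (f * g) x = f (g x) := rfl

theorem Ellis.smul_mul [ContinuousConstSMul T X] (t : T) (f g : Ellis T X) :
    (t • f) * g = t • (f * g) := rfl

theorem Ellis.ofGroup_mul [ContinuousConstSMul T X] (t : T) (f : Ellis T X) :
    Ellis.ofGroup X t * f = t • f := rfl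

theorem Ellis.continuous_mul_right [ContinuousConstSMul T X] (g : Ellis T X) :
    Continuous (fun f : Ellis T X => f * g) :=
  Continuous.subtype_mk (continuous_pi fun x => Ellis.continuous_eval (g x)) _

/-- An Ellis morphism: a continuous, `T`-equivariant morphism of monoids `E(X) → E(Y)`. -/
structure EllisMorphism (T : Type w) (X : Type u) (Y : Type v) [Group T] [TopologicalSpace X]
    [MulAction T X] [TopologicalSpace Y] [MulAction T Y] [ContinuousConstSMul T X]
    [ContinuousConstSMul T Y] extends Ellis T X →* Ellis T Y where
  continuous_toFun : Continuous toFun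
  map_smul' : ∀ (t : T) (f : Ellis T X), toFun (t • f) = t • toFun f

instance [ContinuousConstSMul T X] [ContinuousConstSMul T Y] :
    CoeFun (EllisMorphism T X Y) (fun _ => Ellis T X → Ellis T Y) := ⟨fun Φ => Φ.toMonoidHom⟩

theorem IsFactorMap.ellis_congr [T2Space Y] {φ : X → Y} (hφ : IsFactorMap T φ)
    (f : Ellis T X) {x y : X} (h : φ x = φ y) : φ (f x) = φ (f y) := by
  have hcl : IsClosed {g : X → X | φ (g x) = φ (g y)} :=
    isClosed_eq (hφ.continuous.comp (continuous_apply x)) (hφ.continuous.comp (continuous_apply y))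
  refine closure_minimal ?_ hcl f.2
  rintro _ ⟨t, rfl⟩
  change φ (t • x) = φ (t • y)
  rw [hφ.map_smul, hφ.map_smul, h]

/-- The map `φ_* : E(X) → E(Y)` induced by a factor map `φ`: `φ_*(f)(y) = φ(f(x))` for any
preimage `x` of `y`; see `IsFactorMap.star_apply` for the independence of the preimage. -/
noncomputable def IsFactorMap.star {φ : X → Y} (hφ : IsFactorMap T φ) (f : Ellis T X) :
    Ellis T Y :=
  ⟨fun y => φ (f (Function.surjInv hφ.surjective y)), by
    have hc : Continuous (fun (g : X → X) (y : Y) => φ (g (Function.surjInv hφ.surjective y))) :=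
      continuous_pi fun y => hφ.continuous.comp (continuous_apply _)
    refine map_mem_closure hc f.2 ?_
    rintro _ ⟨t, rfl⟩
    refine ⟨t, funext fun y => ?_⟩
    change t • y = φ (t • Function.surjInv hφ.surjective y)
    rw [hφ.map_smul, Function.surjInv_eq hφ.surjective]⟩

theorem IsFactorMap.star_apply [T2Space Y] {φ : X → Y} (hφ : IsFactorMap T φ) (f : Ellis T X)
    (x : X) : hφ.star f (φ x) = φ (f x) :=
  hφ.ellis_congr f (Function.surjInv_eq hφ.surjective (φ x))

end Ellis

/-! ### Minimal left ideals, the structure group and the little structure group -/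

section Ideals

variable {T : Type w} {X : Type u} [Group T] [TopologicalSpace X] [MulAction T X]
  [ContinuousConstSMul T X]

/-- The left ideal `L = E(X) e`. -/
def leftIdeal (e : Ellis T X) : Set (Ellis T X) := Set.range fun f => f * e

instance [CompactSpace X] (e : Ellis T X) : CompactSpace (leftIdeal e) :=
  isCompact_iff_compactSpace.mp (isCompact_range (Ellis.continuous_mul_right e))

/-- The action `σ_L` of `T` on `L = E(X) e`. -/
instance (e : Ellis T X) : MulAction T (leftIdeal e) where
  smul t f := ⟨t • f.1, by
    obtain ⟨g, hg⟩ := f.2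
    exact ⟨t • g, by rw [← hg]; rfl⟩⟩
  one_smul f := Subtype.ext (one_smul T f.1)
  mul_smul s t f := Subtype.ext (mul_smul s t f.1)

theorem leftIdeal_coe_smul {e : Ellis T X} (t : T) (f : leftIdeal e) :
    ((t • f : leftIdeal e) : Ellis T X) = t • (f : Ellis T X) := rfl

instance (e : Ellis T X) : ContinuousConstSMul T (leftIdeal e) where
  continuous_const_smul t := (continuous_subtype_val.const_smul t).subtype_mk _

/-- The element `e` of `E(X) e`. -/
def leftIdeal.base (e : Ellis T X) : leftIdeal e := ⟨e, 1, rfl⟩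

theorem leftIdeal.dense_orbit_base (e : Ellis T X) :
    Dense (MulAction.orbit T (leftIdeal.base e)) := by
  let r : Ellis T X → leftIdeal e := fun f => ⟨f * e, f, rfl⟩
  have hr : Continuous r := (Ellis.continuous_mul_right e).subtype_mk _
  have hs : Function.Surjective r := by
    rintro ⟨_, f, rfl⟩
    exact ⟨f, rfl⟩
  refine (hs.denseRange.dense_image hr Ellis.denseRange_ofGroup).mono ?_
  rintro _ ⟨_, ⟨t, rfl⟩, rfl⟩
  exact ⟨t, rfl⟩

/-- `J_L`, the set of idempotents of `L = E(X) e`. -/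
def leftIdempotents (e : Ellis T X) : Set (Ellis T X) := {p | p * p = p ∧ p ∈ leftIdeal e}

/-- The set of idempotents of the right ideal `e E(X)`. -/
def rightIdempotents (e : Ellis T X) : Set (Ellis T X) :=
  {q | q * q = q ∧ ∃ f : Ellis T X, e * f = q}

/-- Minimal idempotents of `E(X)`: those `e` such that `e p = p e = p` for an idempotent `p`
implies `p = e`. -/
structure MinimalIdempotent (T : Type w) (X : Type u) [Group T] [TopologicalSpace X]
    [MulAction T X] [ContinuousConstSMul T X] where
  val : Ellis T X
  idem : val * val = val
  eq_of_le : ∀ p : Ellis T X, p * p = p → val * p = p → p * val = p → p = val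

/-- The structure group `𝒢 = e L = e E(X) e`. -/
def structureGroup (e : MinimalIdempotent T X) : Set (Ellis T X) :=
  (fun f => e.val * f) '' leftIdeal e.val

theorem mem_structureGroup_iff {e : MinimalIdempotent T X} {g : Ellis T X} :
    g ∈ structureGroup e ↔ e.val * g = g ∧ g * e.val = g := by
  constructor
  · rintro ⟨_, ⟨f, rfl⟩, rfl⟩
    exact ⟨by simp only [← mul_assoc, e.idem], by simp only [mul_assoc, e.idem]⟩
  · rintro ⟨h1, h2⟩
    exact ⟨g, ⟨g, h2⟩, h1⟩

theorem structureGroup_exists_left_inv [CompactSpace X] [T2Space X] {e : MinimalIdempotent T X}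
    {g : Ellis T X} (hg : g ∈ structureGroup e) : ∃ h ∈ structureGroup e, h * g = e.val := by
  obtain ⟨h1, h2⟩ := mem_structureGroup_iff.mp hg
  obtain ⟨q, ⟨h, rfl⟩, hq⟩ := exists_idempotent_in_compact_subsemigroup
    (Ellis.continuous_mul_right (T := T) (X := X)) (leftIdeal g) ⟨_, 1, rfl⟩
    (isCompact_range (Ellis.continuous_mul_right g)) (by
      rintro _ ⟨a, rfl⟩ _ ⟨b, rfl⟩
      exact ⟨a * g * b, by simp only [mul_assoc]⟩)
  change (h * g) * (h * g) = h * g at hq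
  have hqe : (h * g) * e.val = h * g := by rw [mul_assoc, h2]
  have hp : e.val * (h * g) = e.val := by
    apply e.eq_of_le
    · calc e.val * (h * g) * (e.val * (h * g))
          = e.val * ((h * g) * e.val * (h * g)) := by simp only [mul_assoc]
        _ = e.val * (h * g) := by rw [hqe, hq]
    · rw [← mul_assoc, e.idem]
    · rw [mul_assoc, hqe]
  refine ⟨e.val * h * e.val, mem_structureGroup_iff.mpr ⟨?_, ?_⟩, ?_⟩
  · simp only [← mul_assoc, e.idem]
  · simp only [mul_assoc, e.idem]
  · rw [mul_assoc, h1, mul_assoc, hp]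

/-- `𝒢` is a group under composition, with neutral element `e`. -/
noncomputable instance [CompactSpace X] [T2Space X] (e : MinimalIdempotent T X) :
    Group (structureGroup e) :=
  let m : Mul (structureGroup e) := ⟨fun g h => ⟨g.1 * h.1, by
    obtain ⟨hg, -⟩ := mem_structureGroup_iff.mp g.2
    obtain ⟨-, hh⟩ := mem_structureGroup_iff.mp h.2
    exact mem_structureGroup_iff.mpr ⟨by rw [← mul_assoc, hg], by rw [mul_assoc, hh]⟩⟩⟩
  let o : One (structureGroup e) := ⟨⟨e.val, mem_structureGroup_iff.mpr ⟨e.idem, e.idem⟩⟩⟩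
  let i : Inv (structureGroup e) := ⟨fun g => ⟨(structureGroup_exists_left_inv g.2).choose,
    (structureGroup_exists_left_inv g.2).choose_spec.1⟩⟩
  Group.ofLeftAxioms (fun _ _ _ => Subtype.ext (mul_assoc _ _ _))
    (fun g => Subtype.ext (mem_structureGroup_iff.mp g.2).1)
    (fun g => Subtype.ext (structureGroup_exists_left_inv g.2).choose_spec.2)

theorem structureGroup_coe_mul [CompactSpace X] [T2Space X] {e : MinimalIdempotent T X}
    (g h : structureGroup e) : ((g * h : structureGroup e) : Ellis T X) = g.1 * h.1 := rfl

theorem structureGroup_coe_one [CompactSpace X] [T2Space X] {e : MinimalIdempotent T X} :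
    ((1 : structureGroup e) : Ellis T X) = e.val := rfl

/-- The sandwich matrix of the kernel of `E(X)`, normalised at `e`. The kernel is the Rees matrix
semigroup with structure group `𝒢`, with `J_L` (idempotents of `E(X) e`) and the idempotents of
`e E(X)` as index sets, where `(p, g, q)` stands for `p g q`; since
`(p g q)(p' g' q') = p (g (q p') g') q'`, its sandwich matrix has entries `q p'`. -/
def sandwichMatrix (e : MinimalIdempotent T X) (q : rightIdempotents e.val)
    (p : leftIdempotents e.val) : structureGroup e :=
  ⟨q.1 * p.1, by
    obtain ⟨f, hf⟩ := q.2.2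
    obtain ⟨g, hg⟩ := p.2.2
    change g * e.val = p.1 at hg
    refine mem_structureGroup_iff.mpr ⟨?_, ?_⟩
    · rw [← hf]; simp only [← mul_assoc, e.idem]
    · rw [← hg]; simp only [mul_assoc, e.idem]⟩

/-- The little structure group `Γ`, generated by the entries of the sandwich matrix. -/
noncomputable def littleStructureGroup [CompactSpace X] [T2Space X] (e : MinimalIdempotent T X) :
    Subgroup (structureGroup e) :=
  Subgroup.closure (Set.range fun a : rightIdempotents e.val × leftIdempotents e.val =>
    sandwichMatrix e a.1 a.2)

/-- The stabiliser of `x` in `𝒢`. -/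
def stabilizer (e : MinimalIdempotent T X) (x : X) : Set (Ellis T X) :=
  {g | g ∈ structureGroup e ∧ g x = x}

end Ideals

/-! ### Fibre structure and the NES property

The group structure of `X_eq` is determined by its neutral element, here denoted `o`, and enters
the notions below only through `o`. -/

section Fibres

variable {T : Type w} {X : Type u} [Group T] [TopologicalSpace X] [MulAction T X]

/-- The map `ev_o ∘ (π_eq)_* : E(X) → X_eq`. -/
noncomputable def piTilde (o : MEF T X) (f : Ellis T X) : MEF T X :=
  (isFactorMap_piEq (T := T) (X := X)).star f o

theorem piTilde_piEq (x : X) (f : Ellis T X) : piTilde (piEq T x) f = piEq T (f x) :=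
  isFactorMap_piEq.star_apply f x

theorem continuous_piTilde (o : MEF T X) : Continuous (piTilde o) := by
  obtain ⟨x, rfl⟩ := piEq_surjective o
  have h : piTilde (piEq T x) = fun f : Ellis T X => piEq T (f x) := funext (piTilde_piEq x)
  rw [h]
  exact continuous_piEq.comp (Ellis.continuous_eval x)

variable [ContinuousConstSMul T X]

theorem piTilde_smul (o : MEF T X) (t : T) (f : Ellis T X) :
    piTilde o (t • f) = t • piTilde o f := by
  obtain ⟨x, rfl⟩ := piEq_surjective o
  simp only [piTilde_piEq]
  rfl

/-- `𝒢^fib`, the elements of `𝒢` which preserve the fibre of `o` under `π_eq`, hence all fibres. -/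
def fibGroup (e : MinimalIdempotent T X) (o : MEF T X) : Set (structureGroup e) :=
  {g | piTilde o g.1 = o}

/-- No extra spectrum: the closure in `𝒢` (with the topology of pointwise convergence) of the
normal closure of `Γ` in `𝒢` is `𝒢^fib`. -/
def NES [CompactSpace X] [T2Space X] (e : MinimalIdempotent T X) (o : MEF T X) : Prop :=
  closure (Subgroup.normalClosure (littleStructureGroup e : Set (structureGroup e)) :
    Set (structureGroup e)) = fibGroup e o

theorem surjective_of_dense_orbit {Y : Type v} [TopologicalSpace Y] [T2Space Y] [MulAction T Y]
    [CompactSpace X] {e : Ellis T X} {π : leftIdeal e → Y} (hπ : Continuous π)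
    (hT : ∀ (t : T) f, π (t • f) = t • π f)
    (hd : Dense (MulAction.orbit T (π (leftIdeal.base e)))) : Function.Surjective π := by
  rw [← Set.range_eq_univ, ← (isCompact_range hπ).isClosed.closure_eq, ← dense_iff_closure_eq]
  refine hd.mono ?_
  rintro _ ⟨t, rfl⟩
  exact ⟨t • leftIdeal.base e, hT t _⟩

theorem isFactorMap_piTilde [CompactSpace X] [MulAction.IsMinimal T X] (e : Ellis T X)
    (o : MEF T X) : IsFactorMap T (fun f : leftIdeal e => piTilde o f.1) where
  continuous := (continuous_piTilde o).comp continuous_subtype_val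
  surjective := surjective_of_dense_orbit ((continuous_piTilde o).comp continuous_subtype_val)
    (fun t f => piTilde_smul o t f.1) (MulAction.dense_orbit T _)
  map_smul t f := piTilde_smul o t f.1

/-- The factor map `η_0 : L_eq → X_eq` with `η_0 ∘ π_eq^L = ev_o ∘ (π_eq)_*` on `L = E(X) e`. -/
noncomputable def etaZero [CompactSpace X] [MulAction.IsMinimal T X] (e : Ellis T X)
    (o : MEF T X) : MEF T (leftIdeal e) → MEF T X :=
  mefLift isEquicontinuous_MEF (isFactorMap_piTilde e o)

theorem etaZero_surjective [CompactSpace X] [MulAction.IsMinimal T X] (e : Ellis T X)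
    (o : MEF T X) : Function.Surjective (etaZero e o) := by
  intro ξ
  obtain ⟨f, rfl⟩ := (isFactorMap_piTilde e o).surjective ξ
  exact ⟨piEq T f, rfl⟩

end Fibres

/-! ### Constructions from an Ellis morphism -/

section Morphism

variable {T : Type w} {X : Type u} {Y : Type v} [Group T] [TopologicalSpace X] [MulAction T X]
  [ContinuousConstSMul T X] [TopologicalSpace Y] [MulAction T Y] [ContinuousConstSMul T Y]

theorem EllisMorphism.surjective [CompactSpace X] [T2Space Y] (Φ : EllisMorphism T X Y) :
    Function.Surjective Φ := by
  have hc : Continuous Φ := Φ.continuous_toFun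
  rw [← Set.range_eq_univ, ← (isCompact_range hc).isClosed.closure_eq, ← dense_iff_closure_eq]
  refine Ellis.denseRange_ofGroup.mono ?_
  rintro _ ⟨t, rfl⟩
  refine ⟨t • 1, ?_⟩
  have h1 : Φ 1 = 1 := Φ.map_one'
  have h2 : Φ (t • 1) = t • Φ 1 := Φ.map_smul' t 1
  rw [h2, h1]
  rfl

/-- The minimal idempotent `e' = Φ(e)`. -/
def EllisMorphism.mapIdem [CompactSpace X] [T2Space X] [T2Space Y] (Φ : EllisMorphism T X Y)
    (e : MinimalIdempotent T X) : MinimalIdempotent T Y where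
  val := Φ e.val
  idem := by
    have h : Φ (e.val * e.val) = Φ e.val * Φ e.val := Φ.map_mul' _ _
    rw [← h, e.idem]
  eq_of_le := by
    have hm : ∀ a b, Φ (a * b) = Φ a * Φ b := Φ.map_mul'
    intro p hp h1 h2
    obtain ⟨f, rfl⟩ := Φ.surjective p
    have hg : Φ (e.val * f * e.val) = Φ f := by rw [hm, hm, h1, h2]
    obtain ⟨h, -, hh⟩ := structureGroup_exists_left_inv (e := e) (g := e.val * f * e.val)
      (mem_structureGroup_iff.mpr
        ⟨by simp only [← mul_assoc, e.idem], by simp only [mul_assoc, e.idem]⟩)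
    have h3 : Φ e.val = Φ h * Φ f := by rw [← hh, hm, hg]
    rw [← h1, h3, mul_assoc, hp]

/-- The restriction of `Φ` to a map `L = E(X) e → L' = E(Y) Φ(e)`. -/
def EllisMorphism.restrict (Φ : EllisMorphism T X Y) (e : Ellis T X) (f : leftIdeal e) :
    leftIdeal (Φ e) :=
  ⟨Φ f.1, by
    obtain ⟨g, hg⟩ := f.2
    exact ⟨Φ g, by rw [← hg]; exact (Φ.map_mul' g e).symm⟩⟩

theorem EllisMorphism.isFactorMap_restrict [CompactSpace X] [T2Space Y] (Φ : EllisMorphism T X Y)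
    (e : Ellis T X) : IsFactorMap T (Φ.restrict e) := by
  have hc : Continuous Φ := Φ.continuous_toFun
  have h1 : Continuous (Φ.restrict e) := (hc.comp continuous_subtype_val).subtype_mk _
  have h2 : ∀ (t : T) f, Φ.restrict e (t • f) = t • Φ.restrict e f :=
    fun t f => Subtype.ext (Φ.map_smul' t f.1)
  exact ⟨h1, surjective_of_dense_orbit h1 h2 (leftIdeal.dense_orbit_base (Φ e)), h2⟩

theorem IsFactorMap.comp {X₁ : Type*} {X₂ : Type*} {X₃ : Type*} [TopologicalSpace X₁]
    [TopologicalSpace X₂] [TopologicalSpace X₃] [MulAction T X₁] [MulAction T X₂] [MulAction T X₃]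
    {ψ : X₂ → X₃} {φ : X₁ → X₂} (hψ : IsFactorMap T ψ) (hφ : IsFactorMap T φ) :
    IsFactorMap T (ψ ∘ φ) :=
  ⟨hψ.continuous.comp hφ.continuous, hψ.surjective.comp hφ.surjective, fun t x => by
    simp only [Function.comp, hφ.map_smul, hψ.map_smul]⟩

/-- The map `Φ_eq : L_eq → L'_eq` induced by `Φ` on the maximal equicontinuous factors. -/
def EllisMorphism.phiEq [CompactSpace X] [CompactSpace Y] [T2Space Y] (Φ : EllisMorphism T X Y)
    (e : Ellis T X) : MEF T (leftIdeal e) → MEF T (leftIdeal (Φ e)) :=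
  mefLift isEquicontinuous_MEF (isFactorMap_piEq.comp (Φ.isFactorMap_restrict e))

/-- The map `η_0' ∘ Φ_eq ∘ η_0⁻¹ : X_eq → Y_eq`. The map `η_0` is always surjective, and `surjInv`
is its inverse as soon as it is injective, which is the case for systems without extra
spectrum. -/
noncomputable def EllisMorphism.phiTilde [CompactSpace X] [CompactSpace Y] [T2Space Y]
    [MulAction.IsMinimal T X] [MulAction.IsMinimal T Y] (Φ : EllisMorphism T X Y)
    (e : Ellis T X) (o : MEF T X) (o' : MEF T Y) : MEF T X → MEF T Y :=
  etaZero (Φ e) o' ∘ Φ.phiEq e ∘ Function.surjInv (etaZero_surjective e o)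

end Morphism

end EllisTheory

/-! By minimality every point of `X` is `f x` for some `f` in `L`, so the only candidate for `φ` is
`f x ↦ Φ(f) x'`. Since `L` is compact, evaluation at `x` is a quotient map `L → X`; once `φ` is well
defined it is therefore continuous, and it intertwines `f` with `Φ(f)`, so that `Φ = φ_*`
(`EllisMorphism.exists_factorMap`).

For well-definedness let `f x = g x`. Write `f = p h` with `h = e f` in `𝒢` and `p = f h⁻¹` in
`J_L`, and likewise `g = q k`. Applying `e` gives `h x = k x`, so `k⁻¹ h` stabilises `x` and the
stabiliser hypothesis yields `Φ(h) x' = Φ(k) x'`. It remains to compare `Φ(p)` and `Φ(q)` at this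
point, knowing that `p` and `q` agree at `h x`. If `h x` lies over a singular point, the injectivity
hypothesis forces `p = q`. Otherwise `Φ(h) x'` also lies over a regular point, and every idempotent
fixes it, because a point and its image under an idempotent are proximal and lie in the same fibre
(`IsRegular.idempotent_apply`).

The regular case needs the induced map to send the class of `h x` to that of `Φ(h) x'`
(`EllisMorphism.phiTilde_piTilde`), hence that `η_0` is injective (`NES.etaZero_injective`).
Idempotents act trivially on `L_eq`, so the kernel of the action of `𝒢` on `L_eq` is a closed normal
subgroup containing `Γ`. By NES it contains `𝒢^fib`, which is exactly what injectivity requires. -/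

namespace EllisTheory

/-! ### Proximality, idempotents and regular fibres. -/

section Proximality

variable {T : Type w} [Group T]

/-- Proximal points of an equicontinuous system coincide. -/
theorem IsEquicontinuous.eq_of_proximal {Y : Type v} [TopologicalSpace Y] [CompactSpace Y]
    [T2Space Y] [MulAction T Y] (hY : IsEquicontinuous T Y) {y z : Y} (h : Proximal T y z) :
    y = z := by
  let u : UniformSpace Y := uniformSpaceOfCompactR1
  have hue : UniformEquicontinuous (fun (t : T) (y : Y) => t • y) :=
    CompactSpace.uniformEquicontinuous_of_equicontinuous hY
  refine eq_of_forall_symmetric fun {V} hV _ => ?_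
  -- Some translate of the pair is so close that all its translates are `V`-close; translating back
  -- by `t⁻¹` shows that the original pair is.
  obtain ⟨t, ht⟩ := h _ (hue V hV)
  simpa using ht t⁻¹

variable {X : Type u} [TopologicalSpace X] [MulAction T X]

/-- Two points whose orbit maps extend continuously to `E(X)` are proximal as soon as the
extensions have a common value. -/
theorem proximal_of_ellis_eq {Z : Type v} [TopologicalSpace Z] [CompactSpace Z] [T2Space Z]
    [MulAction T Z] {F G : Ellis T X → Z} (hF : Continuous F) (hG : Continuous G) {y z : Z}
    (hFy : ∀ t : T, F (Ellis.ofGroup X t) = t • y) (hGz : ∀ t : T, G (Ellis.ofGroup X t) = t • z)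
    {p : Ellis T X} (hp : F p = G p) : Proximal T y z := by
  intro V hV
  let u : UniformSpace Z := uniformSpaceOfCompactR1
  -- At `p` the pair lies on the diagonal, so near `p` it stays in `V`; by density some `σ^t` is
  -- that near.
  have hmem : ∀ᶠ a in 𝓝 p, (F a, G a) ∈ V := by
    have hnhds : V ∈ 𝓝 (F p, G p) := by
      rw [← hp]
      exact nhds_le_uniformity _ hV
    exact (hF.prodMk hG).continuousAt.eventually hnhds
  obtain ⟨t, ht⟩ := Ellis.denseRange_ofGroup.exists_mem_open isOpen_interior
    ⟨p, mem_interior_iff_mem_nhds.mpr hmem⟩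
  refine ⟨t, ?_⟩
  have := interior_subset ht
  simpa [hFy, hGz] using this

/-- In a minimal system `E(X) x = X`. -/
theorem Ellis.exists_apply_eq [CompactSpace X] [T2Space X] [MulAction.IsMinimal T X] (x y : X) :
    ∃ f : Ellis T X, f x = y := by
  have hr : Set.range (fun f : Ellis T X => f x) = Set.univ := by
    rw [← (isCompact_range (Ellis.continuous_eval x)).isClosed.closure_eq,
      ← dense_iff_closure_eq]
    refine (MulAction.dense_orbit T x).mono ?_
    rintro _ ⟨t, rfl⟩
    exact ⟨Ellis.ofGroup X t, rfl⟩
  exact hr.symm.subset (Set.mem_univ y)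

variable [ContinuousConstSMul T X]

/-- A point is proximal to its image under an idempotent of `E(X)`. -/
theorem proximal_idempotent_apply [CompactSpace X] [T2Space X] {p : Ellis T X} (hp : p * p = p)
    (y : X) : Proximal T y (p y) :=
  -- Evaluations at `y` and at `p y` agree at `p`, as `p (p y) = p y`.
  proximal_of_ellis_eq (Ellis.continuous_eval y) (Ellis.continuous_eval (p y))
    (fun _ => rfl) (fun _ => rfl) (p := p) (by rw [← Ellis.mul_apply, hp])

/-- Idempotents of `E(X)` act trivially on the maximal equicontinuous factor. -/
theorem piEq_idempotent_apply [CompactSpace X] {p : Ellis T X} (hp : p * p = p)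
    (y : X) : piEq T (p y) = piEq T y :=
  (isEquicontinuous_MEF.eq_of_proximal <|
    proximal_of_ellis_eq (continuous_piEq.comp (Ellis.continuous_eval y))
      (continuous_piEq.comp (Ellis.continuous_eval (p y))) (fun _ => rfl) (fun _ => rfl) (p := p)
      (by simp only [Function.comp, ← Ellis.mul_apply, hp])).symm

/-- Idempotents fix the points over regular points of the maximal equicontinuous factor. -/
theorem IsRegular.idempotent_apply [CompactSpace X] [T2Space X] {p : Ellis T X} (hp : p * p = p)
    {y : X} (hy : IsRegular (piEq T y)) : p y = y := by
  by_contra hne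
  exact hy ⟨y, p y, rfl, piEq_idempotent_apply hp y, Ne.symm hne, proximal_idempotent_apply hp y⟩

end Proximality

/-! ### The action of `E(X)` on the left ideal `L` and on `L_eq`, and injectivity of `η_0`. -/

section LeftIdeals

variable {T : Type w} {X : Type u} [Group T] [TopologicalSpace X] [MulAction T X]
  [ContinuousConstSMul T X]

theorem mul_self_of_mem_leftIdeal {e f : Ellis T X} (he : e * e = e) (hf : f ∈ leftIdeal e) :
    f * e = f := by
  obtain ⟨g, rfl⟩ := hf
  change g * e * e = g * e
  rw [mul_assoc, he]

/-- Left multiplication of `E(X)` on the left ideal `E(X) e`. -/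
def leftIdeal.mulLeft {e : Ellis T X} (a : Ellis T X) (l : leftIdeal e) : leftIdeal e :=
  ⟨a * l.1, by
    obtain ⟨g, hg⟩ := l.2
    exact ⟨a * g, by rw [← hg]; rfl⟩⟩

theorem leftIdeal.mulLeft_mul {e : Ellis T X} (a b : Ellis T X) (l : leftIdeal e) :
    leftIdeal.mulLeft (a * b) l = leftIdeal.mulLeft a (leftIdeal.mulLeft b l) := rfl

theorem leftIdeal.continuous_mulLeft {e : Ellis T X} (l : leftIdeal e) :
    Continuous (fun a => leftIdeal.mulLeft a l) :=
  (Ellis.continuous_mul_right l.1).subtype_mk _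

theorem leftIdeal.continuous_piEq_mulLeft {e : Ellis T X} (l : leftIdeal e) :
    Continuous (fun a => piEq T (leftIdeal.mulLeft a l)) :=
  continuous_piEq.comp (leftIdeal.continuous_mulLeft l)

/-- Left multiplication descends to the maximal equicontinuous factor of `E(X) e`. -/
theorem leftIdeal.piEq_mulLeft_congr {e : Ellis T X} (a : Ellis T X)
    {l m : leftIdeal e} (h : piEq T l = piEq T m) :
    piEq T (leftIdeal.mulLeft a l) = piEq T (leftIdeal.mulLeft a m) := by
  -- For a fixed `a`, left multiplication by `a` need not be continuous, so the argument varies `a`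
  -- instead and extends from the dense image of `T`.
  have hcl : IsClosed {a | piEq T (leftIdeal.mulLeft a l) = piEq T (leftIdeal.mulLeft a m)} :=
    isClosed_eq (leftIdeal.continuous_piEq_mulLeft l) (leftIdeal.continuous_piEq_mulLeft m)
  refine Ellis.denseRange_ofGroup.induction_on a hcl fun t => ?_
  change t • piEq T l = t • piEq T m
  rw [h]

/-- The orbit maps of the classes of `l` and `p l` in `L_eq` extend to `E(X)` and agree at `p`, so
these classes are proximal, and proximal points of an equicontinuous system coincide. -/
theorem leftIdeal.piEq_idempotent_mulLeft [CompactSpace X] {e p : Ellis T X} (hp : p * p = p)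
    (l : leftIdeal e) : piEq T (leftIdeal.mulLeft p l) = piEq T l :=
  (isEquicontinuous_MEF.eq_of_proximal <|
    proximal_of_ellis_eq (leftIdeal.continuous_piEq_mulLeft l)
      (leftIdeal.continuous_piEq_mulLeft (leftIdeal.mulLeft p l))
      (fun _ => rfl) (fun _ => rfl) (p := p) (by rw [← leftIdeal.mulLeft_mul, hp])).symm

variable [CompactSpace X] [T2Space X]

/-- The elements of `𝒢` acting trivially on the maximal equicontinuous factor of `E(X) e`. -/
def eqKernel (e : MinimalIdempotent T X) : Subgroup (structureGroup e) where
  carrier := {g | ∀ l : leftIdeal e.val, piEq T (leftIdeal.mulLeft g.1 l) = piEq T l}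
  one_mem' := leftIdeal.piEq_idempotent_mulLeft e.idem
  mul_mem' {g h} hg hh l := (hg (leftIdeal.mulLeft h.1 l)).trans (hh l)
  inv_mem' {g} hg l := by
    -- Triviality of `g` is used backwards: the class of `g⁻¹ l` is that of `g g⁻¹ l = e l`.
    rw [← hg, ← leftIdeal.mulLeft_mul, ← structureGroup_coe_mul, mul_inv_cancel]
    exact leftIdeal.piEq_idempotent_mulLeft e.idem l

instance (e : MinimalIdempotent T X) : (eqKernel e).Normal where
  conj_mem k hk g l := by
    have h1 := leftIdeal.piEq_mulLeft_congr g.1 (hk (leftIdeal.mulLeft (g⁻¹).1 l))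
    have h2 : leftIdeal.mulLeft g.1 (leftIdeal.mulLeft (g⁻¹).1 l) = leftIdeal.mulLeft e.val l := by
      rw [← leftIdeal.mulLeft_mul, ← structureGroup_coe_mul, mul_inv_cancel,
        structureGroup_coe_one]
    exact (h1.trans (congrArg (piEq T) h2)).trans (leftIdeal.piEq_idempotent_mulLeft e.idem l)

theorem isClosed_eqKernel (e : MinimalIdempotent T X) :
    IsClosed (eqKernel e : Set (structureGroup e)) := by
  change IsClosed {g : structureGroup e |
    ∀ l : leftIdeal e.val, piEq T (leftIdeal.mulLeft g.1 l) = piEq T l}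
  simp only [Set.ofPred_forall]
  exact isClosed_iInter fun l => isClosed_eq
    ((leftIdeal.continuous_piEq_mulLeft l).comp continuous_subtype_val) continuous_const

/-- A generator `q p` acts as a product of two idempotents, each trivial on `L_eq`. -/
theorem littleStructureGroup_le_eqKernel (e : MinimalIdempotent T X) :
    littleStructureGroup e ≤ eqKernel e := by
  refine (Subgroup.closure_le _).mpr ?_
  rintro _ ⟨⟨q, p⟩, rfl⟩ l
  exact (leftIdeal.piEq_idempotent_mulLeft q.2.1 (leftIdeal.mulLeft p.1 l)).trans
    (leftIdeal.piEq_idempotent_mulLeft p.2.1 l)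

/-- The kernel is closed, normal and contains `Γ`, hence contains the closed normal hull of `Γ`,
which NES identifies with `𝒢^fib`. -/
theorem NES.fibGroup_subset_eqKernel {e : MinimalIdempotent T X} {o : MEF T X} (h : NES e o) :
    fibGroup e o ⊆ eqKernel e := by
  rw [← h]
  exact closure_minimal (Subgroup.normalClosure_le_normal (littleStructureGroup_le_eqKernel e))
    (isClosed_eqKernel e)

/-- The element `e f` of `𝒢`. -/
def toStructureGroup (e : MinimalIdempotent T X) (f : leftIdeal e.val) : structureGroup e :=
  ⟨e.val * f.1, f.1, f.2, rfl⟩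

/-- Together with `mul_inv_toStructureGroup_mem` this is the Rees decomposition of `L`: an
idempotent of `J_L` times an element of `𝒢`. -/
theorem mul_inv_mul_toStructureGroup {e : MinimalIdempotent T X} (f : leftIdeal e.val) :
    f.1 * ((toStructureGroup e f)⁻¹ : structureGroup e).1 * (toStructureGroup e f).1 = f.1 := by
  rw [mul_assoc, ← structureGroup_coe_mul, inv_mul_cancel, structureGroup_coe_one,
    mul_self_of_mem_leftIdeal e.idem f.2]

theorem mul_inv_toStructureGroup_mem {e : MinimalIdempotent T X} (f : leftIdeal e.val) :
    f.1 * ((toStructureGroup e f)⁻¹ : structureGroup e).1 ∈ leftIdempotents e.val := by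
  set h := toStructureGroup e f with hh
  have hinv := mem_structureGroup_iff.mp (h⁻¹).2
  refine ⟨?_, f.1 * (h⁻¹).1, by change f.1 * (h⁻¹).1 * e.val = _; rw [mul_assoc, hinv.2]⟩
  -- Inserting `e` turns `h⁻¹ f` into `h⁻¹ e f`, and `e f = h`.
  have h1 : (h⁻¹).1 * f.1 = e.val := by
    conv_lhs => rw [← hinv.2, mul_assoc]
    change ((h⁻¹ * h : structureGroup e) : Ellis T X) = _
    rw [inv_mul_cancel, structureGroup_coe_one]
  calc f.1 * (h⁻¹).1 * (f.1 * (h⁻¹).1) = f.1 * ((h⁻¹).1 * f.1 * (h⁻¹).1) := by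
        simp only [mul_assoc]
    _ = f.1 * (h⁻¹).1 := by rw [h1, hinv.1]

/-- In a minimal system without extra spectrum the factor map `η_0` is injective. -/
theorem NES.etaZero_injective [MulAction.IsMinimal T X] {e : MinimalIdempotent T X} {o : MEF T X}
    (hNES : NES e o) : Function.Injective (etaZero e.val o) := by
  intro a b hab
  obtain ⟨f, rfl⟩ := piEq_surjective a
  obtain ⟨g, rfl⟩ := piEq_surjective b
  obtain ⟨z, rfl⟩ := piEq_surjective o
  change piTilde (piEq T z) f.1 = piTilde (piEq T z) g.1 at hab
  rw [piTilde_piEq, piTilde_piEq] at hab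
  set h := toStructureGroup e f with hh
  set k := toStructureGroup e g with hk
  -- Since `f` and `g` send `z` to the same fibre, so do `h = e f` and `k = e g`; then `k⁻¹ h`
  -- preserves the fibre of `z`.
  have hfib : k⁻¹ * h ∈ fibGroup e (piEq T z) := by
    change piTilde (piEq T z) (k⁻¹ * h).1 = _
    have h1 : piEq T (h.1 z) = piEq T (k.1 z) := isFactorMap_piEq.ellis_congr e.val hab
    have h2 := isFactorMap_piEq.ellis_congr (k⁻¹).1 h1
    rw [← Ellis.mul_apply, ← Ellis.mul_apply, ← structureGroup_coe_mul, ← structureGroup_coe_mul,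
      inv_mul_cancel, structureGroup_coe_one, piEq_idempotent_apply e.idem] at h2
    rw [piTilde_piEq, h2]
  -- Triviality of `k⁻¹ h` at the class of `e`, multiplied by `k`, identifies the classes of `h` and
  -- `k` in `L_eq`.
  have h3 := leftIdeal.piEq_mulLeft_congr k.1
    (hNES.fibGroup_subset_eqKernel hfib (leftIdeal.base e.val))
  rw [← leftIdeal.mulLeft_mul, ← structureGroup_coe_mul, mul_inv_cancel_left] at h3
  -- Passing from `f` to `e f` loses nothing in `L_eq`, because `e` acts trivially there.
  have key : ∀ f : leftIdeal e.val, piEq T (leftIdeal.mulLeft (toStructureGroup e f).1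
      (leftIdeal.base e.val)) = piEq T f := by
    intro f
    rw [← leftIdeal.piEq_idempotent_mulLeft e.idem f]
    exact congrArg (piEq T) (Subtype.ext
      (mem_structureGroup_iff.mp (toStructureGroup e f).2).2)
  rwa [key, key] at h3

end LeftIdeals

/-! ### The map induced on `X_eq`, and factor maps from Ellis morphisms. -/

section Morphism

variable {T : Type w} {X : Type u} {Y : Type v} [Group T]
  [TopologicalSpace X] [CompactSpace X] [T2Space X] [MulAction T X] [ContinuousConstSMul T X]
  [TopologicalSpace Y] [CompactSpace Y] [T2Space Y] [MulAction T Y] [ContinuousConstSMul T Y]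

/-- Without extra spectrum, `η_0' ∘ Φ_eq ∘ η_0⁻¹` maps `(π_eq)_*(f)(0)` to `(π_eq')_*(Φ(f))(0)`. -/
theorem EllisMorphism.phiTilde_piTilde [MulAction.IsMinimal T X] [MulAction.IsMinimal T Y]
    (Φ : EllisMorphism T X Y) {e : MinimalIdempotent T X} {o : MEF T X} (hNES : NES e o)
    (o' : MEF T Y) (f : leftIdeal e.val) :
    Φ.phiTilde e.val o o' (piTilde o f.1) = piTilde o' (Φ f.1) := by
  -- Both sides have the same image under `η_0`; injectivity makes the chosen preimage the expected
  -- one.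
  have h : Function.surjInv (etaZero_surjective e.val o) (piTilde o f.1) = piEq T f :=
    hNES.etaZero_injective (Function.surjInv_eq (etaZero_surjective e.val o) _)
  change etaZero (Φ e.val) o' (Φ.phiEq e.val _) = _
  rw [h]
  rfl

/-- An Ellis morphism `Φ` is induced by a factor map `x ↦ x'` as soon as `f x ↦ Φ(f) x'` is well
defined on a left ideal `E(X) e` with `e x = x` and `Φ(e) x' = x'`. -/
theorem EllisMorphism.exists_factorMap [MulAction.IsMinimal T X] [MulAction.IsMinimal T Y]
    (Φ : EllisMorphism T X Y) (e : Ellis T X) {x : X} (hx : e x = x) {x' : Y}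
    (hx' : Φ e x' = x')
    (hwd : ∀ f g : leftIdeal e, f.1 x = g.1 x → Φ f.1 x' = Φ g.1 x') :
    ∃ (φ : X → Y) (hφ : IsFactorMap T φ), φ x = x' ∧ ∀ f, Φ f = hφ.star f := by
  have hΦc : Continuous Φ := Φ.continuous_toFun
  have hΦT : ∀ (t : T) f, Φ (t • f) = t • Φ f := Φ.map_smul'
  have hΦm : ∀ f g, Φ (f * g) = Φ f * Φ g := Φ.map_mul'
  have hev : Function.Surjective (fun f : leftIdeal e => f.1 x) := fun y => by
    obtain ⟨f, rfl⟩ := Ellis.exists_apply_eq (T := T) x y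
    exact ⟨⟨f * e, f, rfl⟩, congrArg f hx⟩
  have hq : IsQuotientMap (fun f : leftIdeal e => f.1 x) :=
    ((Ellis.continuous_eval x).comp continuous_subtype_val).isClosedMap.isQuotientMap
      ((Ellis.continuous_eval x).comp continuous_subtype_val) hev
  let φ : X → Y := fun y => Φ (Function.surjInv hev y).1 x'
  have hφ_apply : ∀ f : leftIdeal e, φ (f.1 x) = Φ f.1 x' := fun f =>
    hwd _ _ (Function.surjInv_eq hev (f.1 x))
  -- The intertwining relation, which is what identifies `Φ` with `φ_*`.
  have hφ_mul : ∀ f y, φ (f y) = Φ f (φ y) := by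
    intro f y
    obtain ⟨g, rfl⟩ := hev y
    have h := hφ_apply (leftIdeal.mulLeft f g)
    change φ (f (g.1 x)) = Φ (f * g.1) x' at h
    rw [h, hφ_apply, hΦm, Ellis.mul_apply]
  have hφ : IsFactorMap T φ := by
    refine ⟨hq.continuous_iff.mpr ?_, ?_, ?_⟩
    · have : φ ∘ (fun f : leftIdeal e => f.1 x) = fun f => Φ f.1 x' := funext hφ_apply
      rw [this]
      exact (Ellis.continuous_eval x').comp (hΦc.comp continuous_subtype_val)
    · intro y'
      obtain ⟨f', rfl⟩ := Ellis.exists_apply_eq (T := T) x' y'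
      obtain ⟨f, rfl⟩ := Φ.surjective f'
      -- The factor `e` moves `f` into the left ideal, at no cost because `Φ(e)` fixes `x'`.
      refine ⟨(f * e) x, ?_⟩
      rw [hφ_apply ⟨f * e, f, rfl⟩, hΦm, Ellis.mul_apply, hx']
    · intro t y
      obtain ⟨f, rfl⟩ := hev y
      have h := hφ_apply (t • f)
      rw [leftIdeal_coe_smul, hΦT] at h
      rw [hφ_apply]
      exact h
  refine ⟨φ, hφ, ?_, fun f => Ellis.ext fun y' => ?_⟩
  · have h := hφ_apply (leftIdeal.base e)
    change φ (e x) = Φ e x' at h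
    rwa [hx, hx'] at h
  · obtain ⟨y, rfl⟩ := hφ.surjective y'
    rw [hφ.star_apply, hφ_mul]

end Morphism

end EllisTheory

open EllisTheory in
theorem mainTheorem1 {T : Type w} {X : Type u} {X' : Type v} [CommGroup T]
    [TopologicalSpace X] [CompactSpace X] [T2Space X] [MulAction T X] [ContinuousConstSMul T X]
    [TopologicalSpace X'] [CompactSpace X'] [T2Space X'] [MulAction T X']
    [ContinuousConstSMul T X']
    [MulAction.IsMinimal T X] [MulAction.IsMinimal T X']
    (hX : ¬ EllisTheory.IsDistal T X) (hX' : ¬ EllisTheory.IsDistal T X')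
    (o : EllisTheory.MEF T X) (ho : EllisTheory.IsSingular o)
    (o' : EllisTheory.MEF T X') (ho' : EllisTheory.IsSingular o')
    (Φ : EllisTheory.EllisMorphism T X X') (e : EllisTheory.MinimalIdempotent T X)
    (hNES : EllisTheory.NES e o) (hNES' : EllisTheory.NES (Φ.mapIdem e) o')
    (x : X) (hx : x ∈ e.val '' (EllisTheory.piEq T ⁻¹' {o}))
    (x' : X') (hx' : x' ∈ (Φ e.val) '' (EllisTheory.piEq T ⁻¹' {o'}))
    (h_sep : ∀ ξ : EllisTheory.MEF T X, EllisTheory.IsSingular ξ →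
      ∀ y : X, EllisTheory.piEq T y = ξ →
        Set.InjOn (fun p : EllisTheory.Ellis T X => p y) (EllisTheory.leftIdempotents e.val))
    (h_reg : ∀ ξ : EllisTheory.MEF T X, EllisTheory.IsRegular ξ →
      EllisTheory.IsRegular (Φ.phiTilde e.val o o' ξ))
    (h_stab : Φ '' EllisTheory.stabilizer e x ⊆ EllisTheory.stabilizer (Φ.mapIdem e) x') :
    ∃ (φ : X → X') (hφ : EllisTheory.IsFactorMap T φ), φ x = x' ∧ ∀ f, Φ f = hφ.star f := by
  obtain ⟨z, rfl, rfl⟩ := hx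
  obtain ⟨z', rfl, rfl⟩ := hx'
  have hΦm : ∀ f g, Φ (f * g) = Φ f * Φ g := Φ.map_mul'
  have hidem' : Φ e.val * Φ e.val = Φ e.val := (Φ.mapIdem e).idem
  set x := e.val z with hx_def
  set x' := Φ e.val z' with hx'_def
  have hx : e.val x = x := by rw [hx_def, ← Ellis.mul_apply, e.idem]
  have hx' : Φ e.val x' = x' := by rw [hx'_def, ← Ellis.mul_apply, hidem']
  have ho_eq : piEq T z = piEq T x := (piEq_idempotent_apply e.idem z).symm
  have ho_eq' : piEq T z' = piEq T x' := (piEq_idempotent_apply hidem' z').symm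
  refine Φ.exists_factorMap e.val hx hx' fun f g hfg => ?_
  have hf := mul_inv_mul_toStructureGroup f
  have hg := mul_inv_mul_toStructureGroup g
  have hp := mul_inv_toStructureGroup_mem f
  have hq := mul_inv_toStructureGroup_mem g
  -- Left multiplication by `e` removes the idempotent parts of `f` and `g`.
  have hhk : (toStructureGroup e f).1 x = (toStructureGroup e g).1 x := congrArg e.val hfg
  -- From here on only `f = p h`, `g = q k`, `h x = k x` and the membership of `p`, `q` in `J_L`
  -- matter.
  generalize toStructureGroup e f = h at *
  generalize toStructureGroup e g = k at *
  generalize f.1 * (h⁻¹).1 = p at *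
  generalize g.1 * (k⁻¹).1 = q at *
  have hhk' : Φ h.1 x' = Φ k.1 x' := by
    have hst : (k⁻¹ * h).1 x = x := by
      rw [structureGroup_coe_mul, Ellis.mul_apply, hhk, ← Ellis.mul_apply,
        ← structureGroup_coe_mul, inv_mul_cancel, structureGroup_coe_one, hx]
    have hst' : Φ (k⁻¹ * h).1 x' = x' := (h_stab ⟨_, ⟨(k⁻¹ * h).2, hst⟩, rfl⟩).2
    calc Φ h.1 x' = Φ (k * (k⁻¹ * h)).1 x' := by rw [mul_inv_cancel_left]
      _ = Φ k.1 x' := by rw [structureGroup_coe_mul, hΦm, Ellis.mul_apply, hst']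
  rw [← hf, ← hg, Ellis.mul_apply, Ellis.mul_apply, ← hhk] at hfg
  rw [← hf, ← hg, hΦm, hΦm, Ellis.mul_apply, Ellis.mul_apply, ← hhk']
  by_cases hs : IsSingular (piEq T (h.1 x))
  -- Over a singular point, agreement of `p` and `q` at `h x` already gives `p = q`.
  · rw [h_sep _ hs _ rfl hp hq hfg]
  · have hreg := h_reg _ hs
    -- Taken at `h`, this puts `Φ(h) x'` over the image of the regular class of `h x`, so the
    -- idempotents `Φ(p)` and `Φ(q)` both fix it.
    have hphi := Φ.phiTilde_piTilde hNES (piEq T z')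
      ⟨h.1, h.1, (mem_structureGroup_iff.mp h.2).2⟩
    rw [ho_eq, ho_eq', piTilde_piEq, piTilde_piEq] at hphi
    rw [ho_eq, ho_eq', hphi] at hreg
    rw [hreg.idempotent_apply (by rw [← hΦm, hp.1]),
      hreg.idempotent_apply (by rw [← hΦm, hq.1])]
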